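/- Let $(X,d)$ be a metric space which is proper (closed balls are compact), geodesic (any two points are joined by a geodesic segment, i.e. an isometrically embedded compact interval) and Gromov hyperbolic (there is $\delta\ge 0$ such that in every geodesic triangle each side lies in the $\delta$-neighbourhood of the union of the other two). Fix a base point $o\in X$. The Gromov boundary $\partial_G X$ is the set of geodesic rays $\gamma:[0,\infty)\to X$ with $\gamma(0)=o$, where $\gamma\sim\eta$ if $\sup_{t\ge 0} d(\gamma(t),\eta(t))<\infty$. For a geodesic $\sigma$ starting at $o$ let $\mathrm{End}(\sigma)$ be its last point if $\sigma$ is a segment and its class in $\partial_G X$ if $\sigma$ is a ray. A sequence $\xi_n$ converges to $\xi$ in the Gromov compactification $X\cup\partial_G X$ if, for every choice of geodesics $\sigma_n$ with $\sigma_n(0)=o$ and $\mathrm{End}(\sigma_n)=\xi_n$, every subsequence of $(\sigma_n)$ has a further subsequence converging locally uniformly to a geodesic $\sigma$ with $\mathrm{End}(\sigma)=\xi$. Let $f,g:X\to X$ be 1-Lipschitz maps with $f\circ g=g\circ f$. Suppose that there are $\xi_f\neq\xi_g$ in $\partial_G X$ and $x_0\in X$ such that $$\lim_{n\to\infty} f^n(x_0)=\xi_f\quad\text{and}\quad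 \lim_{n\to\infty} g^n(x_0)=\xi_g$$ in the Gromov compactification. Then there exist a closed subset $M\subset X$ which is totally geodesic, in the sense that any two points of $M$ are joined by a geodesic segment of $X$ contained in $M$, and a 1-Lipschitz map $\rho:X\to X$ with $\rho(X)=M$, such that: 1. $\rho\circ\rho=\rho$ (so $\rho$ is a retraction of $X$ onto $M$); 2. $f(M)=g(M)=M$, and $f|_M$ and $g|_M$ are isometries of $(M,d|_M)$. -/

import Mathlib

open scoped NNReal Topology
open Filter

namespace GromovHyp

variable {X : Type*} [MetricSpace X]

/-- `γ` restricted to `[a, b]` is a geodesic segment, i.e. an isometric embedding of `[a, b]`. -/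
def IsGeodesicOn (γ : ℝ → X) (a b : ℝ) : Prop :=
  ∀ s ∈ Set.Icc a b, ∀ t ∈ Set.Icc a b, dist (γ s) (γ t) = |s - t|

/-- Every two points of `X` can be joined by a geodesic segment. -/
def IsGeodesicSpace (X : Type*) [MetricSpace X] : Prop :=
  ∀ x y : X, ∃ (a b : ℝ) (γ : ℝ → X), a ≤ b ∧ IsGeodesicOn γ a b ∧ γ a = x ∧ γ b = y

/-- A geodesic triangle: three geodesic segments `γ i : [a i, b i] → X`, `a i < b i`, each ending
where the next one (cyclically) starts. -/
structure GeodesicTriangle (X : Type*) [MetricSpace X] where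
  a : Fin 3 → ℝ
  b : Fin 3 → ℝ
  γ : Fin 3 → ℝ → X
  lt : ∀ i, a i < b i
  geodesic : ∀ i, IsGeodesicOn (γ i) (a i) (b i)
  closes : ∀ i, γ i (b i) = γ (i + 1) (a (i + 1))

/-- The `i`-th side of a triangle, as a subset of `X`. -/
def GeodesicTriangle.side (T : GeodesicTriangle X) (i : Fin 3) : Set X :=
  T.γ i '' Set.Icc (T.a i) (T.b i)

/-- Each side is contained in the `δ`-neighbourhood of the union of the other two. -/
def GeodesicTriangle.IsThin (T : GeodesicTriangle X) (δ : ℝ) : Prop :=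
  ∀ i, ∀ x ∈ T.side i, ∃ y ∈ T.side (i + 1) ∪ T.side (i + 2), dist x y ≤ δ

/-- Gromov hyperbolicity (for geodesic spaces): all geodesic triangles are uniformly thin. -/
def IsGromovHyperbolic (X : Type*) [MetricSpace X] : Prop :=
  ∃ δ : ℝ, 0 ≤ δ ∧ ∀ T : GeodesicTriangle X, T.IsThin δ

/-- A geodesic ray `[0, ∞) → X` starting at `o`. -/
structure GeodesicRay (o : X) where
  toFun : ℝ≥0 → X
  isometry : Isometry toFun
  source : toFun 0 = o

/-- A geodesic segment `[0, R] → X` starting at `o`. So that segments and rays can be compared as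
maps on `[0, ∞)`, it is extended by its end point `σ(R)` to all `t ≥ R`. -/
structure GeodesicSegment (o : X) where
  length : ℝ≥0
  toFun : ℝ≥0 → X
  geodesic : ∀ s ≤ length, ∀ t ≤ length, dist (toFun s) (toFun t) = dist s t
  source : toFun 0 = o
  const : ∀ t, length ≤ t → toFun t = toFun length

/-- Two rays from `o` are equivalent if they stay at bounded distance: `sup d(γ(t), η(t)) < ∞`. -/
instance asymptoticSetoid (o : X) : Setoid (GeodesicRay o) where
  r γ η := ∃ C : ℝ, ∀ t, dist (γ.toFun t) (η.toFun t) ≤ C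
  iseqv :=
    { refl := fun γ => ⟨0, fun t => by simp⟩
      symm := fun ⟨C, hC⟩ => ⟨C, fun t => by rw [dist_comm]; exact hC t⟩
      trans := fun ⟨C, hC⟩ ⟨D, hD⟩ =>
        ⟨C + D, fun t => (dist_triangle _ _ _).trans (add_le_add (hC t) (hD t))⟩ }

/-- The Gromov boundary of `X`, with base point `o`: geodesic rays from `o` up to equivalence. -/
def GromovBoundary (o : X) : Type _ := Quotient (asymptoticSetoid o)

/-- The Gromov closure `X ∪ ∂X`. -/
abbrev GromovClosure (o : X) : Type _ := X ⊕ GromovBoundary o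

/-- A geodesic starting at `o`: either a segment or a ray. -/
abbrev BasedGeodesic (o : X) : Type _ := GeodesicSegment o ⊕ GeodesicRay o

/-- The underlying map on `[0, ∞)` (constant after the end point, for a segment). -/
def BasedGeodesic.path {o : X} : BasedGeodesic o → ℝ≥0 → X
  | Sum.inl s => s.toFun
  | Sum.inr r => r.toFun

/-- The class in the Gromov boundary of a geodesic ray. -/
def GeodesicRay.toBoundary {o : X} (r : GeodesicRay o) : GromovBoundary o :=
  Quotient.mk (asymptoticSetoid o) r

/-- `End(σ)`: the last point of a segment, the equivalence class of a ray. -/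
def BasedGeodesic.endpoint {o : X} : BasedGeodesic o → GromovClosure o
  | Sum.inl s => Sum.inl (s.toFun s.length)
  | Sum.inr r => Sum.inr r.toBoundary

/-- Convergence of sequences in the Gromov compactification: `u n → ξ` iff for every choice of
geodesics `σ n` from `o` to `u n`, every subsequence of `σ` has a further subsequence that converges
locally uniformly to a geodesic from `o` to `ξ`. -/
def GromovTendsto {o : X} (u : ℕ → GromovClosure o) (ξ : GromovClosure o) : Prop :=
  ∀ σ : ℕ → BasedGeodesic o, (∀ n, (σ n).endpoint = u n) →
    ∀ φ : ℕ → ℕ, StrictMono φ → ∃ ψ : ℕ → ℕ, StrictMono ψ ∧ ∃ τ : BasedGeodesic o,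
      τ.endpoint = ξ ∧ TendstoLocallyUniformly (fun k => (σ (φ (ψ k))).path) τ.path atTop

/-- `M` is totally geodesic: any two points of `M` are joined by a geodesic segment of `X` that is
contained in `M`. -/
def IsTotallyGeodesic (M : Set X) : Prop :=
  ∀ x ∈ M, ∀ y ∈ M, ∃ (a b : ℝ) (γ : ℝ → X), a ≤ b ∧ IsGeodesicOn γ a b ∧ γ a = x ∧ γ b = y ∧
    ∀ t ∈ Set.Icc a b, γ t ∈ M

end GromovHyp

namespace GromovHyp

/-! ### Thin triangles and the four-point inequality. -/

section FourPoint

variable {X : Type*} [MetricSpace X]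

/-! Hyperbolicity is used only to find maps `f^n g^m`, with both exponents arbitrarily large, that
move `x₀` a bounded distance. Distinct boundary limits bound the Gromov products of `f^n x₀` and
`g^m x₀` (`exists_gromovProduct_le`). If both points are about equally far from `x₀`, the four-point
inequality for `x₀`, `f^n g^m x₀`, `f^n x₀`, `g^m x₀` then keeps `f^n g^m x₀` near `x₀`
(`exists_recurrent`).

The rest is a compactness argument for commuting 1-Lipschitz maps on a proper space. A limit `h` of
such recurrent maps factors through every `f^a g^b`, because the exponents tend to infinity. Limits
of the quotients give a map `q` commuting with `h` and acting as `h⁻¹` on its image: `q h h = h`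
(`exists_regular_limit`). Hence `ρ = q h` is idempotent. It also factors through `f` and `g`, which
makes both invertible on its image (`exists_retraction`). -/

lemma IsGeodesicSpace.exists_geodesic (hgeo : IsGeodesicSpace X) (x y : X) :
    ∃ γ : ℝ → X, IsGeodesicOn γ 0 (dist x y) ∧ γ 0 = x ∧ γ (dist x y) = y := by
  obtain ⟨a, b, γ, hab, hγ, rfl, rfl⟩ := hgeo x y
  have hd : dist (γ a) (γ b) = b - a := by
    rw [hγ a (by simp [hab]) b (by simp [hab]), abs_sub_comm, abs_of_nonneg (by linarith)]
  refine ⟨fun t => γ (a + t), ?_, by simp, by simp [hd]⟩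
  rw [hd]
  intro s hs t ht
  rw [hγ (a + s) ⟨by linarith [hs.1], by linarith [hs.2]⟩ (a + t)
    ⟨by linarith [ht.1], by linarith [ht.2]⟩]
  congr 1
  ring

lemma dist_add_dist_le_of_isGeodesicOn {γ : ℝ → X} {a b s : ℝ} (hγ : IsGeodesicOn γ a b)
    (hs : s ∈ Set.Icc a b) : dist (γ a) (γ s) + dist (γ s) (γ b) ≤ dist (γ a) (γ b) := by
  have hab : a ≤ b := hs.1.trans hs.2
  rw [hγ a ⟨le_rfl, hab⟩ s hs, hγ s hs b ⟨hab, le_rfl⟩, hγ a ⟨le_rfl, hab⟩ b ⟨hab, le_rfl⟩,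
    abs_of_nonpos (by linarith [hs.1]), abs_of_nonpos (by linarith [hs.2]),
    abs_of_nonpos (by linarith)]
  linarith

/-- A point almost on a geodesic from `y` to `z` almost realizes the triangle equality. -/
lemma dist_add_dist_le_of_near {γ : ℝ → X} {a b s δ : ℝ} (hγ : IsGeodesicOn γ a b)
    (hs : s ∈ Set.Icc a b) {p : X} (hp : dist p (γ s) ≤ δ) :
    dist (γ a) p + dist p (γ b) ≤ dist (γ a) (γ b) + 2 * δ := by
  have h1 := dist_add_dist_le_of_isGeodesicOn hγ hs
  have h2 := dist_triangle (γ a) (γ s) p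
  have h3 := dist_triangle p (γ s) (γ b)
  rw [dist_comm (γ s) p] at h2
  linarith

/-- On each side of a thin triangle there is a point that is almost on both other sides. -/
lemma exists_center (hgeo : IsGeodesicSpace X) {δ : ℝ} (hδ : 0 ≤ δ)
    (hthin : ∀ T : GeodesicTriangle X, T.IsThin δ) (x a b : X) {γ : ℝ → X}
    (hγ : IsGeodesicOn γ 0 (dist a b)) (h0 : γ 0 = a) (h1 : γ (dist a b) = b) :
    ∃ t ∈ Set.Icc 0 (dist a b), dist x (γ t) + t ≤ dist x a + 2 * δ ∧
      dist x (γ t) + (dist a b - t) ≤ dist x b + 2 * δ := by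
  -- Sides of a `GeodesicTriangle` have positive length, so coinciding vertices are treated apart.
  by_cases hxa : x = a
  · exact ⟨0, ⟨le_rfl, dist_nonneg⟩, by simp [h0, hδ], by simp [h0, hxa, hδ]⟩
  by_cases hxb : x = b
  · refine ⟨dist a b, ⟨dist_nonneg, le_rfl⟩, ?_, by simp [h1, hδ]⟩
    rw [h1, hxb, dist_comm b a]; simp [hδ]
  by_cases hab : a = b
  · refine ⟨0, ⟨le_rfl, dist_nonneg⟩, by simp [h0, hδ], by simp [h0, hab, hδ]⟩
  obtain ⟨γ₁, hγ₁, h10, h11⟩ := hgeo.exists_geodesic b x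
  obtain ⟨γ₂, hγ₂, h20, h21⟩ := hgeo.exists_geodesic x a
  let T : GeodesicTriangle X :=
    { a := fun _ => 0
      b := ![dist a b, dist b x, dist x a]
      γ := ![γ, γ₁, γ₂]
      lt := by
        intro i
        fin_cases i
        · exact dist_pos.2 hab
        · exact dist_pos.2 (Ne.symm hxb)
        · exact dist_pos.2 hxa
      geodesic := by
        intro i
        fin_cases i
        · exact hγ
        · exact hγ₁
        · exact hγ₂
      closes := by
        intro i
        fin_cases i
        · exact h1.trans h10.symm
        · exact h11.trans h20.symm
        · exact h21.trans h0.symm }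
  have hcont : ContinuousOn γ (Set.Icc 0 (dist a b)) := by
    refine LipschitzOnWith.continuousOn (K := 1) (LipschitzOnWith.of_dist_le_mul ?_)
    intro s hs t ht
    rw [hγ s hs t ht, Real.dist_eq]; simp
  have hda : ∀ t ∈ Set.Icc 0 (dist a b), dist (γ t) a = t := by
    intro t ht
    rw [← h0, hγ t ht 0 ⟨le_rfl, dist_nonneg⟩, sub_zero, abs_of_nonneg ht.1]
  have hdb : ∀ t ∈ Set.Icc 0 (dist a b), dist (γ t) b = dist a b - t := by
    intro t ht
    conv_lhs => rw [← h1]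
    rw [hγ t ht _ ⟨dist_nonneg, le_rfl⟩, abs_sub_comm, abs_of_nonneg (by linarith [ht.2])]
  have hcover : ∀ t ∈ Set.Icc 0 (dist a b), dist x (γ t) + t ≤ dist x a + 2 * δ ∨
      dist x (γ t) + (dist a b - t) ≤ dist x b + 2 * δ := by
    intro t ht
    obtain ⟨y, hy, hyd⟩ := hthin T 0 (γ t) ⟨t, ht, rfl⟩
    rcases hy with ⟨s, hs, rfl⟩ | ⟨s, hs, rfl⟩
    · right
      have := dist_add_dist_le_of_near hγ₁ hs hyd
      rw [h10, h11, dist_comm b, hdb t ht, dist_comm _ x, dist_comm b x] at this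
      linarith
    · left
      have := dist_add_dist_le_of_near hγ₂ hs hyd
      rw [h20, h21, hda t ht] at this
      linarith
  let u : Set.Icc (0 : ℝ) (dist a b) → ℝ := fun t => dist x (γ t) + t
  let v : Set.Icc (0 : ℝ) (dist a b) → ℝ := fun t => dist x (γ t) + (dist a b - t)
  have hγc : Continuous fun t : Set.Icc (0 : ℝ) (dist a b) => γ t :=
    continuousOn_iff_continuous_domRestrict.1 hcont
  have hu : Continuous u := (continuous_const.dist hγc).add continuous_subtype_val
  have hv : Continuous v :=
    (continuous_const.dist hγc).add (continuous_const.sub continuous_subtype_val)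
  have : PreconnectedSpace (Set.Icc (0 : ℝ) (dist a b)) :=
    Subtype.preconnectedSpace isPreconnected_Icc
  -- By thinness, two closed sets cover the side, and each contains an endpoint; connectedness makes
  -- them meet.
  have hpre := isPreconnected_closed_iff.1
    (isPreconnected_univ (α := Set.Icc (0 : ℝ) (dist a b)))
    {t | u t ≤ dist x a + 2 * δ} {t | v t ≤ dist x b + 2 * δ}
    (isClosed_le hu continuous_const) (isClosed_le hv continuous_const)
    (fun t _ => hcover t t.2)
    ⟨⟨0, le_rfl, dist_nonneg⟩, trivial, by simp [u, h0, hδ]⟩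
    ⟨⟨dist a b, dist_nonneg, le_rfl⟩, trivial, by simp [v, h1, hδ]⟩
  obtain ⟨t, -, ht1, ht2⟩ := hpre
  exact ⟨t, t.2, ht1, ht2⟩

/-- The four-point inequality in a geodesic space with thin triangles. -/
lemma four_point (hgeo : IsGeodesicSpace X) {δ : ℝ} (hδ : 0 ≤ δ)
    (hthin : ∀ T : GeodesicTriangle X, T.IsThin δ) (x p a b : X) :
    dist x p + dist a b ≤ max (dist x a + dist p b) (dist x b + dist p a) + 4 * δ := by
  obtain ⟨γ, hγ, h0, h1⟩ := hgeo.exists_geodesic a b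
  obtain ⟨s, hs, hs1, hs2⟩ := exists_center hgeo hδ hthin x a b hγ h0 h1
  obtain ⟨t, ht, ht1, ht2⟩ := exists_center hgeo hδ hthin p a b hγ h0 h1
  have htri : dist x p ≤ dist x (γ s) + |s - t| + dist p (γ t) := by
    have := dist_triangle4 x (γ s) (γ t) p
    rwa [hγ s hs t ht, dist_comm (γ t) p] at this
  rcases le_total s t with hst | hst
  · rw [abs_sub_comm, abs_of_nonneg (by linarith)] at htri
    have := le_max_right (dist x a + dist p b) (dist x b + dist p a)
    linarith
  · rw [abs_of_nonneg (by linarith)] at htri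
    have := le_max_left (dist x a + dist p b) (dist x b + dist p a)
    linarith

/-- Geodesics from `o` stay close up to the Gromov product of their end points. -/
lemma dist_le_of_le_gromovProduct {C : ℝ}
    (h4 : ∀ x p a b : X,
      dist x p + dist a b ≤ max (dist x a + dist p b) (dist x b + dist p a) + C)
    {o a b p q : X} {t : ℝ} (hp : dist o p = t) (hq : dist o q = t)
    (hpa : dist p a = dist o a - t) (hqb : dist q b = dist o b - t)
    (ht : 2 * t ≤ dist o a + dist o b - dist a b) : dist p q ≤ 2 * C := by
  have hpb : dist o a + dist p b ≤ dist o b + dist o a - t + C ∨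
      dist o a + dist p b ≤ dist a b + t + C := by
    have := h4 o a p b
    rw [hp, dist_comm a p, dist_comm a b, hpa] at this
    rcases le_total (t + dist b a) (dist o b + (dist o a - t)) with h | h
    · rw [max_eq_right h] at this; left; linarith
    · rw [max_eq_left h, dist_comm b a] at this; right; linarith
  -- The bound on `t` makes `p` almost lie on a geodesic from `o` to `b`, with error `C`; comparing
  -- `p` with `q` costs another `C`.
  have hpb' : dist p b ≤ dist o b - t + C := by
    rcases hpb with h | h <;> linarith
  have hC : 0 ≤ C := by simpa using h4 o o o o
  have := h4 o b p q
  rw [hp, hq, dist_comm b p, dist_comm b q, hqb] at this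
  rcases le_total (t + (dist o b - t)) (t + dist p b) with h | h
  · rw [max_eq_right h] at this; linarith
  · rw [max_eq_left h] at this; linarith

end FourPoint

/-! ### Sequences converging to boundary points. -/

section Boundary

variable {X : Type*} [MetricSpace X] {o : X}

lemma IsGeodesicSpace.exists_geodesicSegment (hgeo : IsGeodesicSpace X) (o x : X) :
    ∃ σ : GeodesicSegment o, σ.length = nndist o x ∧ σ.toFun σ.length = x := by
  obtain ⟨γ, hγ, h0, h1⟩ := hgeo.exists_geodesic o x
  refine ⟨⟨nndist o x, fun t => γ (min t (nndist o x) : ℝ≥0), ?_, ?_, ?_⟩, rfl, ?_⟩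
  · intro s hs t ht
    rw [min_eq_left hs, min_eq_left ht, hγ s ⟨s.2, by exact_mod_cast hs⟩ t
      ⟨t.2, by exact_mod_cast ht⟩, NNReal.dist_eq]
  · simp [h0]
  · intro t ht
    simp [ht]
  · simpa using h1

lemma GeodesicSegment.dist_source (σ : GeodesicSegment o) {t : ℝ≥0} (ht : t ≤ σ.length) :
    dist o (σ.toFun t) = t := by
  have := σ.geodesic 0 zero_le t ht
  rwa [σ.source, dist_comm 0 t, NNReal.dist_eq, NNReal.coe_zero, sub_zero, NNReal.abs_eq] at this

lemma GeodesicSegment.dist_end (σ : GeodesicSegment o) {t : ℝ≥0} (ht : t ≤ σ.length) :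
    dist (σ.toFun t) (σ.toFun σ.length) = σ.length - t := by
  rw [σ.geodesic t ht _ le_rfl, dist_comm, NNReal.dist_eq, abs_of_nonneg]
  exact sub_nonneg.2 (NNReal.coe_le_coe.2 ht)

/-- Convergence to a boundary point, along a sequence of indices tending to infinity. -/
lemma GromovTendsto.exists_subseq {x : ℕ → X} {ξ : GromovBoundary o}
    (h : GromovTendsto (fun n => Sum.inl (x n)) (Sum.inr ξ : GromovClosure o))
    {σ : ℕ → GeodesicSegment o} (hσ : ∀ n, (σ n).toFun (σ n).length = x n)
    {φ : ℕ → ℕ} (hφ : Tendsto φ atTop atTop) :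
    ∃ ψ : ℕ → ℕ, StrictMono ψ ∧ ∃ r : GeodesicRay o, r.toBoundary = ξ ∧
      ∀ t, Tendsto (fun k => (σ (φ (ψ k))).toFun t) atTop (𝓝 (r.toFun t)) := by
  obtain ⟨θ, hθ, hθφ⟩ := strictMono_subseq_of_tendsto_atTop hφ
  obtain ⟨ψ, hψ, τ, hτ, hlim⟩ := h (fun n => Sum.inl (σ n))
    (fun n => by simp [BasedGeodesic.endpoint, hσ]) (φ ∘ θ) hθφ
  rcases τ with τ | r
  · simp [BasedGeodesic.endpoint] at hτ
  · refine ⟨θ ∘ ψ, hθ.comp hψ, r, Sum.inr_injective hτ, fun t => ?_⟩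
    exact hlim.tendstoLocallyUniformlyOn (s := Set.univ) |>.tendsto_at (Set.mem_univ t)

/-- Otherwise infinitely many segments from `o` are constant after a fixed time, and so is their
limit, which cannot then be a ray. -/
lemma GromovTendsto.tendsto_dist (hgeo : IsGeodesicSpace X) {x : ℕ → X} {ξ : GromovBoundary o}
    (h : GromovTendsto (fun n => Sum.inl (x n)) (Sum.inr ξ : GromovClosure o)) :
    Tendsto (fun n => dist o (x n)) atTop atTop := by
  by_contra hcon
  rw [tendsto_atTop] at hcon
  push Not at hcon
  obtain ⟨L, hL⟩ := hcon
  obtain ⟨φ, hφ, hφL⟩ := extraction_of_frequently_atTop hL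
  choose σ hlen hσ using fun n => hgeo.exists_geodesicSegment o (x n)
  obtain ⟨ψ, -, r, -, hr⟩ := h.exists_subseq hσ hφ.tendsto_atTop
  have hconst : ∀ k, ∀ t : ℝ≥0, L.toNNReal ≤ t →
      (σ (φ (ψ k))).toFun t = (σ (φ (ψ k))).toFun (L.toNNReal) := by
    intro k t ht
    have hle : (σ (φ (ψ k))).length ≤ L.toNNReal := by
      rw [hlen, ← NNReal.coe_le_coe, coe_nndist]
      exact (hφL (ψ k)).le.trans (Real.le_coe_toNNReal L)
    rw [(σ (φ (ψ k))).const t (hle.trans ht), (σ (φ (ψ k))).const _ hle]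
  have heq : r.toFun (L.toNNReal + 1) = r.toFun L.toNNReal :=
    tendsto_nhds_unique (hr _) ((hr L.toNNReal).congr fun k => (hconst k _ (by simp)).symm)
  have := r.isometry.injective heq
  simp at this

/-- Sequences converging to distinct boundary points have bounded Gromov product. -/
lemma exists_gromovProduct_le (hgeo : IsGeodesicSpace X) {C : ℝ}
    (h4 : ∀ x p a b : X,
      dist x p + dist a b ≤ max (dist x a + dist p b) (dist x b + dist p a) + C)
    {x y : ℕ → X} {ξ η : GromovBoundary o} (hne : ξ ≠ η)
    (hx : GromovTendsto (fun n => Sum.inl (x n)) (Sum.inr ξ : GromovClosure o))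
    (hy : GromovTendsto (fun n => Sum.inl (y n)) (Sum.inr η : GromovClosure o)) :
    ∃ D : ℝ, ∀ n m, dist o (x n) + dist o (y m) - dist (x n) (y m) ≤ D := by
  by_contra! hcon
  have key : ∀ k : ℕ, ∃ n m, k ≤ n ∧ k ≤ m ∧
      2 * (k : ℝ) < dist o (x n) + dist o (y m) - dist (x n) (y m) := by
    intro k
    -- The expression is at most `2 * dist o (x n)` and at most `2 * dist o (y m)`. Adding the sum
    -- over `i < k` therefore forces `n, m ≥ k`.
    obtain ⟨n, m, hnm⟩ := hcon (2 * (k : ℝ) +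
      ∑ i ∈ Finset.range k, (2 * dist o (x i) + 2 * dist o (y i)))
    have hsum : ∀ i < k, 2 * dist o (x i) + 2 * dist o (y i) ≤
        ∑ i ∈ Finset.range k, (2 * dist o (x i) + 2 * dist o (y i)) := fun i hi =>
      Finset.single_le_sum (f := fun i => 2 * dist o (x i) + 2 * dist o (y i))
        (fun j _ => by positivity) (Finset.mem_range.2 hi)
    have hpos : 0 ≤ ∑ i ∈ Finset.range k, (2 * dist o (x i) + 2 * dist o (y i)) :=
      Finset.sum_nonneg fun j _ => by positivity
    have hk : (0 : ℝ) ≤ k := k.cast_nonneg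
    refine ⟨n, m, ?_, ?_, by linarith⟩
    · by_contra! hn
      have := hsum n hn
      have := dist_triangle o (x n) (y m)
      linarith [dist_nonneg (x := o) (y := y n)]
    · by_contra! hm
      have := hsum m hm
      have := dist_triangle o (y m) (x n)
      rw [dist_comm (y m)] at this
      linarith [dist_nonneg (x := o) (y := x m)]
  choose n m hn hm hnm using key
  choose σ hσl hσ using fun k => hgeo.exists_geodesicSegment o (x k)
  choose τ hτl hτ using fun k => hgeo.exists_geodesicSegment o (y k)
  obtain ⟨φ, hφ, r, hr, hrlim⟩ := hx.exists_subseq hσ (tendsto_atTop_mono hn tendsto_id)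
  obtain ⟨ψ, hψ, s, hs, hslim⟩ := hy.exists_subseq hτ
    ((tendsto_atTop_mono hm tendsto_id).comp hφ.tendsto_atTop)
  apply hne
  rw [← hr, ← hs]
  -- Segments to `x n` and `y m` stay `2 * C`-close up to half this expression, which tends to
  -- infinity; so the limit rays are equivalent.
  refine Quotient.sound ⟨2 * C, fun t => ?_⟩
  refine le_of_tendsto (((hrlim t).comp hψ.tendsto_atTop).dist (hslim t)) ?_
  have hφψ := (hφ.comp hψ).tendsto_atTop
  filter_upwards [hφψ.eventually_ge_atTop ⌈(t : ℝ)⌉₊] with k hk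
  have hk' : (t : ℝ) ≤ (φ (ψ k) : ℕ) := (Nat.le_ceil _).trans (by exact_mod_cast hk)
  have hprod := hnm (φ (ψ k))
  simp only [Function.comp_apply]
  generalize φ (ψ k) = j at *
  have htx : t ≤ (σ (n j)).length := by
    rw [hσl, ← NNReal.coe_le_coe, coe_nndist]
    have := dist_triangle o (x (n j)) (y (m j))
    linarith
  have hty : t ≤ (τ (m j)).length := by
    rw [hτl, ← NNReal.coe_le_coe, coe_nndist]
    have := dist_triangle o (y (m j)) (x (n j))
    rw [dist_comm (y (m j))] at this
    linarith
  refine dist_le_of_le_gromovProduct h4 (o := o) (a := x (n j)) (b := y (m j)) (t := t)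
    ?_ ?_ ?_ ?_ (by linarith)
  · exact (σ (n j)).dist_source htx
  · exact (τ (m j)).dist_source hty
  · have := (σ (n j)).dist_end htx
    rwa [hσ, hσl, coe_nndist] at this
  · have := (τ (m j)).dist_end hty
    rwa [hτ, hτl, coe_nndist] at this

end Boundary

/-! ### Recurrence of the semigroup generated by `f` and `g`. -/

section Recurrence

variable {X : Type*} [MetricSpace X]

lemma lipschitzWith_one_iterate {f : X → X} (hf : LipschitzWith 1 f) (n : ℕ) :
    LipschitzWith 1 f^[n] := by
  simpa using hf.iterate n

lemma dist_map_le {f : X → X} (hf : LipschitzWith 1 f) (x y : X) :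
    dist (f x) (f y) ≤ dist x y := by
  simpa using hf.dist_le_mul x y

/-- Orbits going to infinity in transversal directions: `f^n g^m` recurs to a bounded set. -/
lemma exists_recurrent {C : ℝ}
    (h4 : ∀ x p a b : X,
      dist x p + dist a b ≤ max (dist x a + dist p b) (dist x b + dist p a) + C)
    {f g : X → X} (hf : LipschitzWith 1 f) (hg : LipschitzWith 1 g) (hfg : Function.Commute f g)
    {x : X} {D : ℝ}
    (hD : ∀ n m, dist x (f^[n] x) + dist x (g^[m] x) - dist (f^[n] x) (g^[m] x) ≤ D)
    (hftop : Tendsto (fun n => dist x (f^[n] x)) atTop atTop)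
    (hgtop : Tendsto (fun n => dist x (g^[n] x)) atTop atTop) :
    ∃ R : ℝ, ∀ N : ℕ, ∃ n m, N ≤ n ∧ N ≤ m ∧ dist (f^[n] (g^[m] x)) x ≤ R := by
  refine ⟨dist x (g x) + D + C, fun N => ?_⟩
  obtain ⟨n, hn, hNn⟩ :=
    ((hftop.eventually_ge_atTop (dist x (g^[N] x))).and (eventually_ge_atTop N)).exists
  have hex : ∃ k, dist x (f^[n] x) ≤ dist x (g^[N + k] x) := by
    obtain ⟨m, hm, hNm⟩ :=
      ((hgtop.eventually_ge_atTop (dist x (f^[n] x))).and (eventually_ge_atTop N)).exists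
    exact ⟨m - N, by rwa [Nat.add_sub_cancel' hNm]⟩
  -- The first `m ≥ N` at which the `g`-orbit is as far out as `f^[n] x` overshoots by at most one
  -- step, `dist x (g x)`. The choice of `n` covers the case `m = N`.
  classical
  have hspec := Nat.find_spec hex
  have hupper : dist x (g^[N + Nat.find hex] x) ≤ dist x (f^[n] x) + dist x (g x) := by
    rcases hk : Nat.find hex with _ | k
    · simpa using hn.trans (le_add_of_nonneg_right dist_nonneg)
    · have hlt : dist x (g^[N + k] x) < dist x (f^[n] x) := by
        have := Nat.find_min hex (m := k) (by omega)
        simpa using this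
      have h1 := dist_triangle x (g^[N + k] x) (g^[N + (k + 1)] x)
      have h2 : dist (g^[N + k] x) (g^[N + (k + 1)] x) ≤ dist x (g x) := by
        rw [← add_assoc, Function.iterate_succ_apply]
        exact dist_map_le (lipschitzWith_one_iterate hg _) _ _
      linarith
  have hNm : N ≤ N + Nat.find hex := Nat.le_add_right _ _
  generalize N + Nat.find hex = m at hNm hspec hupper
  have hpb : dist (f^[n] (g^[m] x)) (g^[m] x) ≤ dist x (f^[n] x) := by
    rw [(hfg.iterate_iterate n m) x, dist_comm]
    exact dist_map_le (lipschitzWith_one_iterate hg m) _ _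
  have hpa : dist (f^[n] (g^[m] x)) (f^[n] x) ≤ dist x (g^[m] x) := by
    rw [dist_comm]
    exact dist_map_le (lipschitzWith_one_iterate hf n) _ _
  have h := h4 x (f^[n] (g^[m] x)) (f^[n] x) (g^[m] x)
  have hD' := hD n m
  refine ⟨n, m, hNn, hNm, ?_⟩
  rw [dist_comm]
  have hmax : max (dist x (f^[n] x) + dist (f^[n] (g^[m] x)) (g^[m] x))
      (dist x (g^[m] x) + dist (f^[n] (g^[m] x)) (f^[n] x)) ≤ 2 * dist x (g^[m] x) :=
    max_le (by linarith) (by linarith)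
  linarith

end Recurrence

/-! ### Limits of recurrent commuting 1-Lipschitz maps. -/

section Limits

variable {X : Type*} [MetricSpace X]

/-- Uniformly bounded `1`-Lipschitz maps have a pointwise limit along every ultrafilter. -/
lemma exists_ultralimit [ProperSpace X] {ι : Type*} (U : Ultrafilter ι) {h : ι → X → X} (x₀ : X) {R : ℝ}
    (hlip : ∀ᶠ i in U, LipschitzWith 1 (h i)) (hbd : ∀ᶠ i in U, dist (h i x₀) x₀ ≤ R) :
    ∃ l : X → X, (∀ x, Tendsto (fun i => h i x) U (𝓝 (l x))) ∧ LipschitzWith 1 l ∧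
      dist (l x₀) x₀ ≤ R := by
  have hpt : ∀ x, ∃ y, Tendsto (fun i => h i x) U (𝓝 y) := by
    intro x
    have hmem : Metric.closedBall x₀ (dist x x₀ + R) ∈ U.map fun i => h i x := by
      rw [Ultrafilter.mem_map]
      filter_upwards [hlip, hbd] with i hi hi'
      rw [Set.mem_preimage, Metric.mem_closedBall]
      have := dist_map_le hi x x₀
      linarith [dist_triangle (h i x) (h i x₀) x₀]
    obtain ⟨y, -, hy⟩ := (isCompact_closedBall x₀ (dist x x₀ + R)).ultrafilter_le_nhds'
      (U.map fun i => h i x) hmem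
    exact ⟨y, hy⟩
  choose l hl using hpt
  refine ⟨l, hl, LipschitzWith.of_dist_le_mul fun x y => ?_, ?_⟩
  · simp only [NNReal.coe_one, one_mul]
    exact le_of_tendsto ((hl x).dist (hl y)) (hlip.mono fun i hi => dist_map_le hi x y)
  · exact le_of_tendsto ((hl x₀).dist tendsto_const_nhds) hbd

/-- Pointwise limits of `1`-Lipschitz maps are compatible with composition. -/
lemma tendsto_comp_of_lipschitz {ι : Type*} {F : Filter ι} {h k : ι → X → X} {h' k' : X → X}
    (hlip : ∀ᶠ i in F, LipschitzWith 1 (h i)) (hh : ∀ x, Tendsto (fun i => h i x) F (𝓝 (h' x)))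
    (hk : ∀ x, Tendsto (fun i => k i x) F (𝓝 (k' x))) (x : X) :
    Tendsto (fun i => h i (k i x)) F (𝓝 (h' (k' x))) := by
  refine (tendsto_iff_of_dist ?_).1 (hh (k' x))
  have h0 : Tendsto (fun i => dist (k' x) (k i x)) F (𝓝 0) := by
    simpa using (tendsto_const_nhds (x := k' x)).dist (hk x)
  exact squeeze_zero' (Eventually.of_forall fun _ => dist_nonneg)
    (hlip.mono fun i hi => dist_map_le hi _ _) h0

lemma commute_of_tendsto {ι : Type*} {F : Filter ι} [F.NeBot] {h : ι → X → X} {h' k : X → X}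
    (hk : Continuous k) (hh : ∀ x, Tendsto (fun i => h i x) F (𝓝 (h' x)))
    (hcomm : ∀ᶠ i in F, Function.Commute (h i) k) : Function.Commute h' k := by
  intro x
  exact tendsto_nhds_unique (hh (k x))
    (((hk.tendsto _).comp (hh x)).congr' (hcomm.mono fun i hi => (hi x).symm))

variable {H : ℕ × ℕ → X → X}

/-- A recurrent commutative semigroup of `1`-Lipschitz maps has a regular limit element `h`, which
is moreover divisible by every element of the semigroup. -/
lemma exists_regular_limit [ProperSpace X] (hlip : ∀ e, LipschitzWith 1 (H e))
    (hadd : ∀ d e x, H (d + e) x = H d (H e x)) (x₀ : X) {R : ℝ}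
    (hrec : ∀ N, ∃ e, N ≤ e ∧ dist (H e x₀) x₀ ≤ R) :
    ∃ h q : X → X, LipschitzWith 1 h ∧ LipschitzWith 1 q ∧ (∀ e, Function.Commute h (H e)) ∧
      (∀ e, Function.Commute q (H e)) ∧ Function.Commute q h ∧ (∀ x, q (h (h x)) = h x) ∧
      ∀ e, ∃ k : X → X, LipschitzWith 1 k ∧ (∀ d, Function.Commute k (H d)) ∧
        ∀ x, h x = H e (k x) := by
  have hcomm : ∀ d e, Function.Commute (H d) (H e) := fun d e x => by
    rw [← hadd, add_comm, hadd]
  choose w hw hwR using fun k : ℕ => hrec (k, k)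
  -- One nonprincipal ultrafilter gives limits at all points simultaneously and lets iterated limits
  -- be compared.
  let U : Ultrafilter ℕ := hyperfilter ℕ
  have hU : ∀ e : ℕ × ℕ, ∀ᶠ l in U, e ≤ w l := by
    intro e
    have : ∀ᶠ l in atTop, e ≤ w l := by
      filter_upwards [eventually_ge_atTop (max e.1 e.2)] with l hl
      exact le_trans ⟨(le_max_left _ _).trans hl, (le_max_right _ _).trans hl⟩ (hw l)
    exact (Nat.hyperfilter_le_atTop) this
  have hlimcomm : ∀ {u : ℕ → X → X} {l : X → X}, (∀ x, Tendsto (fun i => u i x) U (𝓝 (l x))) →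
      (∀ i e, Function.Commute (u i) (H e)) → ∀ e, Function.Commute l (H e) :=
    fun hl hu e => commute_of_tendsto (hlip e).continuous hl (Eventually.of_forall fun i => hu i e)
  -- the limit, after division by an element of the semigroup
  have hdiv : ∀ e, ∃ k : X → X, LipschitzWith 1 k ∧ (∀ d, Function.Commute k (H d)) ∧
      dist (k x₀) x₀ ≤ dist (H e x₀) x₀ + R ∧
      ∀ x, Tendsto (fun l => H (w l) x) U (𝓝 (k (H e x))) := by
    intro e
    have hsub : ∀ᶠ l in U, ∀ x, H (w l) x = H (w l - e) (H e x) := by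
      filter_upwards [hU e] with l hl x
      rw [← hadd, tsub_add_cancel_of_le hl]
    obtain ⟨k, hk, hk1, hkR⟩ := exists_ultralimit U (h := fun l => H (w l - e)) x₀
      (R := dist (H e x₀) x₀ + R) (Eventually.of_forall fun l => hlip _) (by
        filter_upwards [hsub] with l hl
        have h1 := dist_triangle (H (w l - e) x₀) (H (w l - e) (H e x₀)) x₀
        have h2 := dist_map_le (hlip (w l - e)) x₀ (H e x₀)
        have h3 := hwR l
        rw [hl x₀] at h3
        rw [dist_comm x₀] at h2
        linarith)
    refine ⟨k, hk1, hlimcomm hk fun i d => hcomm _ d, hkR, fun x => ?_⟩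
    exact (hk (H e x)).congr' (hsub.mono fun l hl => (hl x).symm)
  obtain ⟨h, hh, hh1, -⟩ := exists_ultralimit U (h := fun l => H (w l)) x₀
    (Eventually.of_forall fun l => hlip _) (Eventually.of_forall hwR)
  choose k hk1 hkc hkR hk using hdiv
  have hkh : ∀ e x, k e (H e x) = h x := fun e x => tendsto_nhds_unique (hk e x) (hh x)
  have hww : ∀ i j, dist (k (w i + w j) x₀) x₀ ≤ R + R + R := by
    intro i j
    refine (hkR _).trans ?_
    rw [hadd]
    have h1 := dist_triangle (H (w i) (H (w j) x₀)) (H (w i) x₀) x₀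
    have h2 := dist_map_le (hlip (w i)) (H (w j) x₀) x₀
    linarith [hwR i, hwR j]
  -- Since `k e` is `h` divided by `H e`, the iterated limit of `k (w i + w j)` plays the role of
  -- `h` divided by `h ∘ h`.
  choose q' hq' hq'1 hq'R using fun j => exists_ultralimit U (h := fun i => k (w i + w j)) x₀
    (Eventually.of_forall fun i => hk1 _) (Eventually.of_forall fun i => hww i j)
  obtain ⟨q, hq, hq1, -⟩ := exists_ultralimit U (h := q') x₀
    (Eventually.of_forall hq'1) (Eventually.of_forall hq'R)
  have hhc : ∀ e, Function.Commute h (H e) := hlimcomm hh fun i d => hcomm _ d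
  have hqc : ∀ e, Function.Commute q (H e) := hlimcomm hq fun j => hlimcomm (hq' j) fun i => hkc _
  have hq'h : ∀ j x, q' j (h (H (w j) x)) = h x := by
    intro j x
    refine tendsto_nhds_unique (tendsto_comp_of_lipschitz (Eventually.of_forall fun i => hk1 _)
      (hq' j) hh (H (w j) x)) ?_
    simp only [← hadd, hkh]
    exact tendsto_const_nhds
  refine ⟨h, q, hh1, hq1, hhc, hqc, ?_, fun x => ?_, fun e => ⟨k e, hk1 e, hkc e, fun x => ?_⟩⟩
  · exact (commute_of_tendsto hq1.continuous hh
      (Eventually.of_forall fun l => (hqc (w l)).symm)).symm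
  · have hlim := tendsto_comp_of_lipschitz (Eventually.of_forall hq'1) hq
      (fun x => (hh1.continuous.tendsto _).comp (hh x)) x
    refine tendsto_nhds_unique hlim ?_
    simp only [Function.comp_apply, hq'h]
    exact tendsto_const_nhds
  · rw [← hkh e x, hkc e e x]

/-- A recurrent commutative semigroup of `1`-Lipschitz maps contains a retraction in its closure,
and acts invertibly on the image of this retraction. -/
lemma exists_retraction [ProperSpace X] (hlip : ∀ e, LipschitzWith 1 (H e))
    (hadd : ∀ d e x, H (d + e) x = H d (H e x)) (x₀ : X) {R : ℝ}
    (hrec : ∀ N, ∃ e, N ≤ e ∧ dist (H e x₀) x₀ ≤ R) :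
    ∃ ρ : X → X, LipschitzWith 1 ρ ∧ (∀ x, ρ (ρ x) = ρ x) ∧ ∀ e, Function.Commute ρ (H e) ∧
      ∃ k : X → X, LipschitzWith 1 k ∧ Function.Commute k (H e) ∧ ∀ x, ρ x = H e (k x) := by
  obtain ⟨h, q, hh, hq, hhc, hqc, hqh, hreg, hdiv⟩ := exists_regular_limit hlip hadd x₀ hrec
  refine ⟨q ∘ h, by simpa using hq.comp hh, fun x => ?_, fun e =>
    ⟨(hqc e).comp_left (hhc e), ?_⟩⟩
  · simp only [Function.comp_apply]
    rw [← hqh (h x), hreg]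
  · obtain ⟨k, hk, hkc, hkh⟩ := hdiv e
    refine ⟨q ∘ k, by simpa using hq.comp hk, (hqc e).comp_left (hkc e), fun x => ?_⟩
    simp only [Function.comp_apply]
    rw [hkh, hqc e]

end Limits

/-! ### Geometry of the image of the retraction. -/

/-- The image under `ρ` of a geodesic with fixed endpoints is again geodesic: shortening any piece
would violate the triangle inequality between the endpoints. -/
lemma IsTotallyGeodesic.range_of_retraction {X : Type*} [MetricSpace X] (hgeo : IsGeodesicSpace X)
    {ρ : X → X} (hρ : LipschitzWith 1 ρ) (hid : ∀ x, ρ (ρ x) = ρ x) :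
    IsTotallyGeodesic (Set.range ρ) := by
  rintro _ ⟨x, rfl⟩ _ ⟨y, rfl⟩
  obtain ⟨γ, hγ, h0, h1⟩ := hgeo.exists_geodesic (ρ x) (ρ y)
  have hρ0 : ρ (γ 0) = γ 0 := by rw [h0, hid]
  have hρ1 : ρ (γ (dist (ρ x) (ρ y))) = γ (dist (ρ x) (ρ y)) := by rw [h1, hid]
  generalize hL : dist (ρ x) (ρ y) = L at *
  have hL0 : 0 ≤ L := hL ▸ dist_nonneg
  refine ⟨0, L, ρ ∘ γ, hL0, ?_, hρ0.trans h0, hρ1.trans h1, fun t _ => ⟨γ t, rfl⟩⟩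
  have key : ∀ s ∈ Set.Icc 0 L, ∀ t ∈ Set.Icc 0 L, s ≤ t → dist (ρ (γ s)) (ρ (γ t)) = |s - t| := by
    intro s hs t ht hst
    refine le_antisymm ((dist_map_le hρ _ _).trans (hγ s hs t ht).le) ?_
    have h2 := (dist_map_le hρ (γ 0) (γ s)).trans (hγ 0 ⟨le_rfl, hL0⟩ s hs).le
    have h3 := (dist_map_le hρ (γ t) (γ L)).trans (hγ t ht L ⟨hL0, le_rfl⟩).le
    have h4 := dist_triangle4 (ρ (γ 0)) (ρ (γ s)) (ρ (γ t)) (ρ (γ L))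
    rw [hρ0, hρ1, h0, h1, hL] at h4
    rw [hρ0, h0] at h2
    rw [hρ1, h1] at h3
    rw [abs_of_nonpos (by linarith [hs.1])] at h2
    rw [abs_of_nonpos (by linarith [ht.2])] at h3
    rw [abs_of_nonpos (by linarith)]
    linarith
  intro s hs t ht
  rcases le_total s t with h | h
  · exact key s hs t ht h
  · rw [dist_comm, abs_sub_comm]
    exact key t ht s hs h

/-- On the range of `ρ`, the map `k` is a 1-Lipschitz left inverse of `f`, so `f` cannot contract
there. As `k` need not preserve the range, preimages are taken with `ρ ∘ k`. -/
lemma image_eq_and_dist_eq_of_retraction {X : Type*} [MetricSpace X] {ρ f k : X → X}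
    (hid : ∀ x, ρ (ρ x) = ρ x) (hf : LipschitzWith 1 f) (hk : LipschitzWith 1 k)
    (hρf : Function.Commute ρ f) (hkf : Function.Commute k f) (h : ∀ x, ρ x = f (k x)) :
    f '' Set.range ρ = Set.range ρ ∧
      ∀ x ∈ Set.range ρ, ∀ y ∈ Set.range ρ, dist (f x) (f y) = dist x y := by
  constructor
  · ext y
    constructor
    · rintro ⟨_, ⟨x, rfl⟩, rfl⟩
      exact ⟨f x, hρf x⟩
    · rintro ⟨x, rfl⟩
      refine ⟨ρ (k (ρ x)), ⟨_, rfl⟩, ?_⟩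
      rw [← hρf (k (ρ x)), ← h, hid, hid]
  · rintro _ ⟨x, rfl⟩ _ ⟨y, rfl⟩
    refine le_antisymm (dist_map_le hf _ _) ?_
    have := dist_map_le hk (f (ρ x)) (f (ρ y))
    rwa [hkf, hkf, ← h, ← h, hid, hid] at this

end GromovHyp

theorem mainTheorem2 {X : Type*} [MetricSpace X] [ProperSpace X]
    (hgeo : GromovHyp.IsGeodesicSpace X) (hhyp : GromovHyp.IsGromovHyperbolic X)
    (f g : X → X) (hf : LipschitzWith 1 f) (hg : LipschitzWith 1 g) (hfg : f ∘ g = g ∘ f)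
    (o : X) (ξf ξg : GromovHyp.GromovBoundary o) (hne : ξf ≠ ξg) (x₀ : X)
    (hξf : GromovHyp.GromovTendsto (fun n : ℕ => Sum.inl (f^[n] x₀)) (Sum.inr ξf))
    (hξg : GromovHyp.GromovTendsto (fun n : ℕ => Sum.inl (g^[n] x₀)) (Sum.inr ξg)) :
    ∃ (M : Set X) (ρ : X → X),
      IsClosed M ∧ GromovHyp.IsTotallyGeodesic M ∧
      LipschitzWith 1 ρ ∧ Set.range ρ = M ∧ ρ ∘ ρ = ρ ∧
      f '' M = M ∧ g '' M = M ∧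
      (∀ x ∈ M, ∀ y ∈ M, dist (f x) (f y) = dist x y) ∧
      (∀ x ∈ M, ∀ y ∈ M, dist (g x) (g y) = dist x y) := by
  have hcomm : Function.Commute f g := fun x => congrFun hfg x
  obtain ⟨δ, hδ, hthin⟩ := hhyp
  have h4 := GromovHyp.four_point hgeo hδ hthin
  obtain ⟨D, hD⟩ := GromovHyp.exists_gromovProduct_le hgeo h4 hne hξf hξg
  have htop : ∀ {u : X → X} {ξ : GromovHyp.GromovBoundary o},
      GromovHyp.GromovTendsto (fun n : ℕ => Sum.inl (u^[n] x₀)) (Sum.inr ξ) →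
      Tendsto (fun n => dist x₀ (u^[n] x₀)) atTop atTop := fun {u ξ} h => by
    refine tendsto_atTop_mono (fun n => ?_)
      (tendsto_atTop_add_const_right _ (-dist o x₀) (h.tendsto_dist hgeo))
    linarith [dist_triangle o x₀ (u^[n] x₀)]
  -- Moving the base point from `o` to `x₀` costs `2 * dist o x₀`.
  obtain ⟨R, hR⟩ := GromovHyp.exists_recurrent h4 hf hg hcomm (x := x₀) (D := D + 2 * dist o x₀)
    (fun n m => by
      have h1 := dist_triangle x₀ o (f^[n] x₀)
      have h2 := dist_triangle x₀ o (g^[m] x₀)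
      rw [dist_comm x₀ o] at h1 h2
      linarith [hD n m]) (htop hξf) (htop hξg)
  let H : ℕ × ℕ → X → X := fun e x => f^[e.1] (g^[e.2] x)
  have hlip : ∀ e, LipschitzWith 1 (H e) := fun e => by
    have h := (GromovHyp.lipschitzWith_one_iterate hf e.1).comp
      (GromovHyp.lipschitzWith_one_iterate hg e.2)
    rwa [mul_one] at h
  have hadd : ∀ d e x, H (d + e) x = H d (H e x) := fun d e x => by
    simp only [H, Prod.fst_add, Prod.snd_add, Function.iterate_add_apply]
    rw [(hcomm.iterate_iterate e.1 d.2) (g^[e.2] x)]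
  obtain ⟨ρ, hρ, hid, hdiv⟩ := GromovHyp.exists_retraction hlip hadd x₀ (R := R) fun N => by
    obtain ⟨n, m, hn, hm, h⟩ := hR (max N.1 N.2)
    exact ⟨(n, m), ⟨(le_max_left _ _).trans hn, (le_max_right _ _).trans hm⟩, h⟩
  obtain ⟨hρf, k, hk, hkf, hρk⟩ := hdiv (1, 0)
  obtain ⟨hρg, l, hl, hlg, hρl⟩ := hdiv (0, 1)
  obtain ⟨hf1, hf2⟩ := GromovHyp.image_eq_and_dist_eq_of_retraction hid hf hk hρf hkf hρk
  obtain ⟨hg1, hg2⟩ := GromovHyp.image_eq_and_dist_eq_of_retraction hid hg hl hρg hlg hρl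
  refine ⟨Set.range ρ, ρ, ?_, GromovHyp.IsTotallyGeodesic.range_of_retraction hgeo hρ hid, hρ, rfl,
    funext hid, hf1, hg1, hf2, hg2⟩
  have hrange : Set.range ρ = {x | ρ x = x} := by
    ext x
    exact ⟨fun ⟨y, hy⟩ => hy ▸ hid y, fun hx => ⟨x, hx⟩⟩
  rw [hrange]
  exact isClosed_eq hρ.continuous continuous_id
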